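/- Let $X$ be a complex Banach space and $T$ a bounded linear operator on $X$, with null space $N(T)$ and range $R(T)$. Put $\alpha(T)=\dim N(T)$ and $\beta(T)=\operatorname{codim} R(T)$, in $\mathbb{N}\cup\{\infty\}$. For $n\in\mathbb{N}=\{0,1,2,\dots\}$ let $T_{[n]}$ be the restriction of $T$ to $R(T^n)$. With $\inf\emptyset=\infty$, put $$a_e(T)=\inf\{n:\alpha(T_{[n]})<\infty\},\quad d_e(T)=\inf\{n:\beta(T_{[n]})<\infty\},\quad m_T=\inf\{n:\min(\alpha(T_{[n]}),\beta(T_{[n]}))<\infty\},$$ $$\operatorname{dis}(T)=\inf\{m : N(T_{[m]})=N(T_{[r]})\text{ for all } r\ge m\}.$$ $T$ is upper semi-B-Fredholm if $a_e(T)<\infty$ and $R(T^{a_e(T)+1})$ is closed, lower semi-B-Fredholm if $d_e(T)<\infty$ and $R(T^{d_e(T)})$ is closed, and semi-B-Fredholm if it is one or the other; it is semi-Fredholm if moreover $m_T=0$. An operator $S$ (on a normed space) is semi-regular if $R(S)$ is closed and $\operatorname{dis}(S)=0$. The reduced minimal modulus is $\gamma(S)=\inf\{\|Sx\|/d(x,N(S))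 : x\notin N(S)\}$. Let $T$ be semi-B-Fredholm, and let $\varepsilon=\gamma(T_{[d]})$ with $d=\operatorname{dis}(T)$. Then $\varepsilon>0$, and there is a unique $j\in\mathbb{N}$ such that for every $\lambda\in\mathbb{C}$ with $0<|\lambda|<\varepsilon$: if $T$ is upper semi-B-Fredholm, then $\alpha(T_{[m_T]})<\infty$ and $j=\alpha(T_{[m_T]})-\alpha(T-\lambda I)$; if $T$ is lower semi-B-Fredholm, then $\beta(T_{[m_T]})<\infty$ and $j=\beta(T_{[m_T]})-\beta(T-\lambda I)$. This number is called $\operatorname{jump}(T)$. Moreover, $$T_{[m_T]}\text{ is semi-regular if and only if }\operatorname{jump}(T)=0.$$ In particular, if $T$ is semi-Fredholm, then $T$ is semi-regular if and only if $\operatorname{jump}(T)=0$. -/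

import Mathlib

open scoped ENNReal

noncomputable section

namespace BFredholm

section Normed

variable {E : Type*} [NormedAddCommGroup E] [NormedSpace ℂ E]

/-- The range `R(T)` of a bounded operator. -/
def rng (T : E →L[ℂ] E) : Submodule ℂ E := LinearMap.range T.toLinearMap

/-- The null space `N(T)` of a bounded operator. -/
def nul (T : E →L[ℂ] E) : Submodule ℂ E := LinearMap.ker T.toLinearMap

/-- `α(T) = dim N(T)`, an element of `ℕ ∪ {∞}`. -/
def alpha (T : E →L[ℂ] E) : ℕ∞ := Cardinal.toENat (Module.rank ℂ (nul T))

/-- `β(T) = codim R(T)`, an element of `ℕ ∪ {∞}`. -/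
def beta (T : E →L[ℂ] E) : ℕ∞ := Cardinal.toENat (Module.rank ℂ (E ⧸ rng T))

/-- `R(T ^ n)` is `T`-invariant. -/
theorem mapsTo_rng_pow (T : E →L[ℂ] E) (n : ℕ) : ∀ x ∈ rng (T ^ n), T x ∈ rng (T ^ n) := by
  rintro _ ⟨y, rfl⟩
  refine ⟨T y, ?_⟩
  change (T ^ n * T) y = (T * T ^ n) y
  rw [← pow_succ, ← pow_succ']

/-- `T_[n]`, the restriction of `T` to a bounded operator on `R(T ^ n)`, which carries
the norm of `E`. -/
def restr (T : E →L[ℂ] E) (n : ℕ) : rng (T ^ n) →L[ℂ] rng (T ^ n) :=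
  T.restrict (mapsTo_rng_pow T n)

/-- The essential ascent `a_e(T) = inf {n : α(T_[n]) < ∞}`, with `inf ∅ = ∞`. -/
def essAscent (T : E →L[ℂ] E) : ℕ∞ :=
  sInf {a : ℕ∞ | ∃ n : ℕ, a = n ∧ alpha (restr T n) < ⊤}

/-- The essential descent `d_e(T) = inf {n : β(T_[n]) < ∞}`, with `inf ∅ = ∞`. -/
def essDescent (T : E →L[ℂ] E) : ℕ∞ :=
  sInf {a : ℕ∞ | ∃ n : ℕ, a = n ∧ beta (restr T n) < ⊤}

/-- The essential degree `m_T = inf {n : min (α(T_[n])) (β(T_[n])) < ∞}`, with `inf ∅ = ∞`. -/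
def essDegree (T : E →L[ℂ] E) : ℕ∞ :=
  sInf {a : ℕ∞ | ∃ n : ℕ, a = n ∧ min (alpha (restr T n)) (beta (restr T n)) < ⊤}

/-- Upper semi-B-Fredholm: `a := a_e(T) < ∞` and `R(T ^ (a + 1))` is closed. -/
def IsUpperSemiBFredholm (T : E →L[ℂ] E) : Prop :=
  ∃ a : ℕ, essAscent T = a ∧ IsClosed (rng (T ^ (a + 1)) : Set E)

/-- Lower semi-B-Fredholm: `b := d_e(T) < ∞` and `R(T ^ b)` is closed. -/
def IsLowerSemiBFredholm (T : E →L[ℂ] E) : Prop :=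
  ∃ b : ℕ, essDescent T = b ∧ IsClosed (rng (T ^ b) : Set E)

/-- Semi-B-Fredholm: upper or lower semi-B-Fredholm. -/
def IsSemiBFredholm (T : E →L[ℂ] E) : Prop :=
  IsUpperSemiBFredholm T ∨ IsLowerSemiBFredholm T

/-- Semi-Fredholm: semi-B-Fredholm with essential degree zero. -/
def IsSemiFredholm (T : E →L[ℂ] E) : Prop :=
  IsSemiBFredholm T ∧ essDegree T = 0

/-- The degree of stable iteration: the infimum (with `inf ∅ = ∞`) of all `m` such that
`N(T_[m]) = N(T_[r])` for all `r ≥ m`. As a subspace of `E`, `N(T_[m])` is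
`N(T) ∩ R(T ^ m)`. -/
def dis (T : E →L[ℂ] E) : ℕ∞ :=
  sInf {a : ℕ∞ | ∃ m : ℕ, a = m ∧
    ∀ r : ℕ, m ≤ r → nul T ⊓ rng (T ^ m) = nul T ⊓ rng (T ^ r)}

/-- Semi-regular: the range is closed and the degree of stable iteration is zero. -/
def IsSemiRegular (T : E →L[ℂ] E) : Prop :=
  IsClosed (rng T : Set E) ∧ dis T = 0

/-- The reduced minimal modulus `γ(T) = inf {‖T x‖ / d(x, N(T)) : x ∉ N(T)}`,
with `inf ∅ = ∞`. -/
def redMinMod (T : E →L[ℂ] E) : ℝ≥0∞ :=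
  ⨅ x : E, ⨅ _ : x ∉ nul T, ENNReal.ofReal (‖T x‖ / Metric.infDist x (nul T : Set E))

/-- `T_[m_T]`, meaningful when `m_T < ∞` (in particular for semi-B-Fredholm `T`). -/
abbrev essRestr (T : E →L[ℂ] E) :
    rng (T ^ (essDegree T).toNat) →L[ℂ] rng (T ^ (essDegree T).toNat) :=
  restr T (essDegree T).toNat

/-- `ε = γ(T_[d])`, where `d = dis T`; meaningful when `dis T < ∞` (in particular for
semi-B-Fredholm `T`). -/
def stabRadius (T : E →L[ℂ] E) : ℝ≥0∞ := redMinMod (restr T (dis T).toNat)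

/-- `HasJump T j`: the radius `ε = γ(T_[d])` is positive and, for every `λ` with
`0 < |λ| < ε`, one has `j = α(T_[m_T]) - α(T - λ)` as a difference of finite numbers if `T`
is upper semi-B-Fredholm, and `j = β(T_[m_T]) - β(T - λ)` as a difference of finite numbers
if `T` is lower semi-B-Fredholm. -/
def HasJump (T : E →L[ℂ] E) (j : ℕ) : Prop :=
  0 < stabRadius T ∧
  ∀ z : ℂ, z ≠ 0 → ‖z‖ₑ < stabRadius T →
    (IsUpperSemiBFredholm T →
      alpha (essRestr T) < ⊤ ∧
        alpha (essRestr T) = alpha (T - z • ContinuousLinearMap.id ℂ E) + j) ∧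
    (IsLowerSemiBFredholm T →
      beta (essRestr T) < ⊤ ∧
        beta (essRestr T) = beta (T - z • ContinuousLinearMap.id ℂ E) + j)

/-- The jump of a semi-B-Fredholm operator: the number `j` with `HasJump T j`
(at most one exists if `T` is semi-B-Fredholm, because the punctured disc is not empty). -/
def jump (T : E →L[ℂ] E) : ℕ := sInf {j : ℕ | HasJump T j}

end Normed

end BFredholm

end

/-! Let N_n = N(T) ∩ R(T^n), the kernel of T_[n], and g_n = dim N_n/N_{n+1} (`nulGap`). Passing from
T_[n] to T_[n+1] lowers the nullity by g_n. It lowers the defect by the same g_n, because T induces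
a surjection R(T^n)/R(T^{n+1}) → R(T^{n+1})/R(T^{n+2}) with kernel isomorphic to N_n/N_{n+1}
(`alpha_restr_eq_add`, `beta_restr_eq_add`). With m = m_T ≤ d = dis(T), the jump is g_m + ... +
g_{d-1}, which is finite because α(T_[m]) or β(T_[m]) is. It vanishes exactly when the kernels N_n
are constant from m on; since R(T^{m+1}) is closed, this is semi-regularity of T_[m].

It remains to identify α(T - λ) with α(T_[d]), and likewise β. For λ ≠ 0, T - λ and T_[d] - λ have
the same nullity and defect (`alpha_sub_restr`, `beta_sub_restr`). The operator V = T_[d] has powers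
with closed range, and N(V) lies in the core C = ⋂ R(V^n). Hence V maps C onto C, and the operator
induced on the quotient by C is bounded below by γ(V). For |λ| < γ(V), V - λ is therefore onto on C
and bounded below on the quotient; its nullity is that of the first operator, its defect that of the
second. These dimensions are lower semicontinuous and, where finite, locally constant in λ, so by
connectedness of the disc they keep their value at 0 (`alpha_sub_eq`, `beta_sub_eq`). -/

noncomputable section

namespace BFredholm

open Filter Topology Function

/-! ### Stability of surjectivity, bijectivity and lower bounds. -/

section Openness

variable {E F : Type*} [NormedAddCommGroup E] [NormedSpace ℂ E] [CompleteSpace E]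
  [NormedAddCommGroup F] [NormedSpace ℂ F]

/-- An operator at distance less than `δ` from one whose preimages can be chosen with
`δ * ‖x‖ ≤ ‖y‖` is surjective. -/
theorem surjective_of_norm_sub_lt {W S : E →L[ℂ] F} {δ : ℝ}
    (hW : ∀ y, ∃ x, W x = y ∧ δ * ‖x‖ ≤ ‖y‖) (hS : ‖S - W‖ < δ) : Surjective S := by
  have hδ : 0 < δ := (norm_nonneg _).trans_lt hS
  choose g hg hgn using hW
  let r : W.NonlinearRightInverse :=
    { toFun := g
      nnnorm := ⟨δ⁻¹, by positivity⟩
      bound' := fun y => by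
        change ‖g y‖ ≤ δ⁻¹ * ‖y‖
        rw [le_inv_mul_iff₀ hδ]
        exact hgn y
      right_inv' := hg }
  have hap : ApproximatesLinearOn S W Set.univ ‖S - W‖₊ := by
    intro x _ y _
    have := (S - W).le_opNorm (x - y)
    simpa [sub_sub_sub_comm] using this
  intro y
  have hpos : 0 < δ - ‖S - W‖ := sub_pos.2 hS
  -- The radius is chosen so that the image contains the closed ball of radius exactly ‖y‖.
  have h := hap.surjOn_closedBall_of_nonlinearRightInverse r (b := 0)
    (ε := ‖y‖ / (δ - ‖S - W‖)) (by positivity) (Set.subset_univ _)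
  have hr : ((r.nnnorm : ℝ)⁻¹ - (‖S - W‖₊ : ℝ)) = δ - ‖S - W‖ := by
    change (δ⁻¹)⁻¹ - ‖S - W‖ = _
    rw [inv_inv]
  rw [hr, mul_div_cancel₀ _ hpos.ne'] at h
  obtain ⟨x, -, hx⟩ := h (show y ∈ Metric.closedBall (S 0) ‖y‖ by simp)
  exact ⟨x, hx⟩

theorem eventually_surjective [CompleteSpace F] {A : E →L[ℂ] F} (hA : Surjective A) :
    ∀ᶠ B : E →L[ℂ] F in 𝓝 A, Surjective B := by
  obtain ⟨C, hC, h⟩ := A.exists_preimage_norm_le hA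
  have : ∀ᶠ B : E →L[ℂ] F in 𝓝 A, ‖B - A‖ < C⁻¹ := eventually_norm_sub_lt _ (by positivity)
  filter_upwards [this] with B hB
  refine surjective_of_norm_sub_lt (W := A) (δ := C⁻¹) (fun y => ?_) hB
  obtain ⟨x, hx, hxy⟩ := h y
  exact ⟨x, hx, by rwa [inv_mul_le_iff₀ hC]⟩

theorem eventually_bijective [CompleteSpace F] {A : E →L[ℂ] F} (hA : Bijective A) :
    ∀ᶠ B : E →L[ℂ] F in 𝓝 A, Bijective B := by
  let e := ContinuousLinearEquiv.ofBijective A (LinearMap.ker_eq_bot.2 hA.1)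
    (LinearMap.range_eq_top.2 hA.2)
  have he : (e : E →L[ℂ] F) = A := ContinuousLinearEquiv.coe_ofBijective _ _ _
  have : ∀ᶠ B : E →L[ℂ] F in 𝓝 A, B ∈ Set.range ((↑) : (E ≃L[ℂ] F) → E →L[ℂ] F) := by
    rw [← he]
    exact ContinuousLinearEquiv.nhds e
  filter_upwards [this] with B hB
  obtain ⟨e', rfl⟩ := hB
  exact e'.bijective

theorem eventually_injective_of_isClosed_range [CompleteSpace F] {A : E →L[ℂ] F}
    (hA : Injective A) (hc : IsClosed (Set.range A)) : ∀ᶠ B : E →L[ℂ] F in 𝓝 A, Injective B := by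
  obtain ⟨K, hK⟩ := A.antilipschitz_of_injective_of_isClosed_range hA hc
  -- K may be 0; K + 1 has a positive inverse.
  have hK' : AntilipschitzWith (K + 1) A := fun x y =>
    (hK x y).trans (mul_le_mul_left (by simp) _)
  have : ∀ᶠ B : E →L[ℂ] F in 𝓝 A, ‖B - A‖₊ < (K + 1)⁻¹ := eventually_nnnorm_sub_lt _ (by positivity)
  filter_upwards [this] with B hB
  exact (hK'.add_sub_lipschitzWith (B - A).lipschitz hB).injective

end Openness

/-! ### Finite-dimensional auxiliary maps. -/

section FiniteRank

variable {E F : Type*} [NormedAddCommGroup E] [NormedSpace ℂ E]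
  [NormedAddCommGroup F] [NormedSpace ℂ F]

theorem rank_eq_of_equiv_fin {M : Type*} [AddCommGroup M] [Module ℂ M] {k : ℕ}
    (e : M ≃ₗ[ℂ] (Fin k → ℂ)) : Module.rank ℂ M = k := by
  rw [rank_eq_card_basis (Module.Basis.ofEquivFun e), Fintype.card_fin]

theorem nonempty_equiv_fin {M : Type*} [AddCommGroup M] [Module ℂ M] {k : ℕ}
    (h : Module.rank ℂ M = k) : Nonempty (M ≃ₗ[ℂ] (Fin k → ℂ)) := by
  have hf : Module.finrank ℂ M = k := Module.finrank_eq_of_rank_eq h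
  have : Module.Finite ℂ M := Module.rank_lt_aleph0_iff.1 (h ▸ Cardinal.natCast_lt_aleph0)
  exact ⟨LinearEquiv.ofFinrankEq _ _ (by simpa using hf)⟩

/-- An injective linear map from `ℂ ^ k` into a normed space has a continuous left inverse. -/
theorem exists_leftInverse_fin {k : ℕ} (j : (Fin k → ℂ) →ₗ[ℂ] E) (hj : Injective j) :
    ∃ ψ : E →L[ℂ] (Fin k → ℂ), ∀ v, ψ (j v) = v := by
  obtain ⟨p, hp⟩ := Submodule.ClosedComplemented.of_finiteDimensional (LinearMap.range j)
  let e := LinearEquiv.ofInjective j hj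
  refine ⟨(LinearMap.toContinuousLinearMap e.symm.toLinearMap).comp p, fun v => ?_⟩
  have : p (j v) = e v := hp (e v)
  simp [this]

theorem continuous_prod_right {k : ℕ} (ψ : E →L[ℂ] (Fin k → ℂ)) :
    Continuous fun B : E →L[ℂ] F => B.prod ψ := by
  have : (fun B : E →L[ℂ] F => B.prod ψ) = fun B =>
      ContinuousLinearMap.compL ℂ E F (F × (Fin k → ℂ))
        (ContinuousLinearMap.inl ℂ F (Fin k → ℂ)) B +
        (ContinuousLinearMap.inr ℂ F (Fin k → ℂ)).comp ψ := by
    ext <;> simp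
  rw [this]
  fun_prop

theorem continuous_coprod_left {k : ℕ} (j : (Fin k → ℂ) →L[ℂ] F) :
    Continuous fun B : E →L[ℂ] F => B.coprod j := by
  have : (fun B : E →L[ℂ] F => B.coprod j) = fun B =>
      ((ContinuousLinearMap.compL ℂ (E × (Fin k → ℂ)) E F).flip
        (ContinuousLinearMap.fst ℂ E (Fin k → ℂ))) B +
        j.comp (ContinuousLinearMap.snd ℂ E (Fin k → ℂ)) := by
    ext <;> simp
  rw [this]
  fun_prop

end FiniteRank

/-! ### Kernel dimension near a surjective operator. -/

section KernelDim

variable {E F : Type*} [NormedAddCommGroup E] [NormedSpace ℂ E] [CompleteSpace E]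
  [NormedAddCommGroup F] [NormedSpace ℂ F] [CompleteSpace F]

/-- Take ψ dual to k independent kernel vectors. Then (A, ψ) is onto F × ℂ^k, hence so is (B, ψ) for
B near A, and ψ maps the kernel of B onto ℂ^k. -/
theorem eventually_le_rank_ker {A : E →L[ℂ] F} (hA : Surjective A) {k : ℕ}
    (hk : (k : Cardinal) ≤ Module.rank ℂ (LinearMap.ker A.toLinearMap)) :
    ∀ᶠ B : E →L[ℂ] F in 𝓝 A, (k : Cardinal) ≤ Module.rank ℂ (LinearMap.ker B.toLinearMap) := by
  obtain ⟨j, hj⟩ := Module.le_rank_iff_exists_linearMap.1 hk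
  obtain ⟨ψ, hψ⟩ := exists_leftInverse_fin ((LinearMap.ker A.toLinearMap).subtype ∘ₗ j)
    ((Submodule.injective_subtype _).comp hj)
  have hs : Surjective (A.prod ψ) := by
    rintro ⟨y, v⟩
    obtain ⟨x, rfl⟩ := hA y
    refine ⟨x + j (v - ψ x), Prod.ext ?_ ?_⟩
    · change A (x + j (v - ψ x)) = A x
      rw [map_add, show A (j (v - ψ x)) = 0 from (j (v - ψ x)).2, add_zero]
    · change ψ (x + j (v - ψ x)) = v
      rw [map_add, show ψ (j (v - ψ x)) = v - ψ x from hψ _, add_sub_cancel]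
  filter_upwards [(continuous_prod_right ψ).continuousAt.eventually (eventually_surjective hs)] with B hB
  have hsB : Surjective (ψ.toLinearMap.domRestrict (LinearMap.ker B.toLinearMap)) := by
    intro v
    obtain ⟨x, hx⟩ := hB (0, v)
    exact ⟨⟨x, congrArg Prod.fst hx⟩, congrArg Prod.snd hx⟩
  obtain ⟨g, hg⟩ := LinearMap.exists_rightInverse_of_surjective _ (LinearMap.range_eq_top.2 hsB)
  exact Module.le_rank_iff_exists_linearMap.2
    ⟨g, LeftInverse.injective (g := ψ.toLinearMap.domRestrict _) fun v => LinearMap.congr_fun hg v⟩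

/-- When the k vectors span the kernel, (A, ψ) is even bijective, so ψ restricts to an isomorphism
from the kernel of B onto ℂ^k. -/
theorem eventually_rank_ker_eq {A : E →L[ℂ] F} (hA : Surjective A) {k : ℕ}
    (hk : Module.rank ℂ (LinearMap.ker A.toLinearMap) = k) :
    ∀ᶠ B : E →L[ℂ] F in 𝓝 A, Module.rank ℂ (LinearMap.ker B.toLinearMap) = k := by
  obtain ⟨e⟩ := nonempty_equiv_fin hk
  obtain ⟨ψ, hψ⟩ := exists_leftInverse_fin
    ((LinearMap.ker A.toLinearMap).subtype ∘ₗ e.symm.toLinearMap)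
    ((Submodule.injective_subtype _).comp e.symm.injective)
  have hψ' : ∀ v, ψ (e.symm v : E) = v := hψ
  have hs : Bijective (A.prod ψ) := by
    constructor
    · refine (injective_iff_map_eq_zero _).2 fun x hx => ?_
      have h1 : A x = 0 := congrArg Prod.fst hx
      have h2 : ψ x = 0 := congrArg Prod.snd hx
      have h3 := hψ' (e ⟨x, h1⟩)
      rw [e.symm_apply_apply] at h3
      have h4 : e ⟨x, h1⟩ = 0 := h3.symm.trans h2
      exact congrArg Subtype.val ((map_eq_zero_iff e e.injective).1 h4)
    · rintro ⟨y, v⟩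
      obtain ⟨x, rfl⟩ := hA y
      refine ⟨x + e.symm (v - ψ x), Prod.ext ?_ ?_⟩
      · change A (x + e.symm (v - ψ x)) = A x
        rw [map_add, show A (e.symm (v - ψ x)) = 0 from (e.symm (v - ψ x)).2, add_zero]
      · change ψ (x + e.symm (v - ψ x)) = v
        rw [map_add, hψ', add_sub_cancel]
  filter_upwards [(continuous_prod_right ψ).continuousAt.eventually (eventually_bijective hs)] with B hB
  refine rank_eq_of_equiv_fin
    (LinearEquiv.ofBijective (ψ.toLinearMap.domRestrict (LinearMap.ker B.toLinearMap)) ⟨?_, ?_⟩)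
  · refine (injective_iff_map_eq_zero _).2 fun x hx => ?_
    have : (x : E) = 0 := hB.1 ((Prod.ext x.2 hx : B.prod ψ x = (0, 0)).trans (map_zero _).symm)
    exact Subtype.ext this
  · intro v
    obtain ⟨x, hx⟩ := hB.2 (0, v)
    exact ⟨⟨x, congrArg Prod.fst hx⟩, congrArg Prod.snd hx⟩

end KernelDim

/-! ### Codimension of the range near an injective operator. -/

section Codim

variable {E F : Type*} [NormedAddCommGroup E] [NormedSpace ℂ E] [CompleteSpace E]
  [NormedAddCommGroup F] [NormedSpace ℂ F] [CompleteSpace F]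

/-- Dual device: adjoin to A an embedding j of ℂ^k transverse to its range. The map (x, v) ↦ A x + j
v is injective with closed range, and this injectivity survives small perturbation of A. -/
theorem eventually_le_codim_range {A : E →L[ℂ] F} (hA : Injective A)
    (hc : IsClosed (Set.range A)) {k : ℕ}
    (hk : (k : Cardinal) ≤ Module.rank ℂ (F ⧸ LinearMap.range A.toLinearMap)) :
    ∀ᶠ B : E →L[ℂ] F in 𝓝 A, (k : Cardinal) ≤ Module.rank ℂ (F ⧸ LinearMap.range B.toLinearMap) := by
  obtain ⟨C, hC⟩ := Submodule.exists_isCompl (LinearMap.range A.toLinearMap)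
  rw [(Submodule.quotientEquivOfIsCompl _ _ hC).rank_eq] at hk
  obtain ⟨j₀, hj₀⟩ := Module.le_rank_iff_exists_linearMap.1 hk
  let j : (Fin k → ℂ) →L[ℂ] F := LinearMap.toContinuousLinearMap (C.subtype ∘ₗ j₀)
  have hjC : ∀ v, j v ∈ C := fun v => (j₀ v).2
  have hj : Injective j := (Submodule.injective_subtype _).comp hj₀
  have hinj : Injective (A.coprod j) := by
    refine (injective_iff_map_eq_zero _).2 fun ⟨x, v⟩ hx => ?_
    have hx' : A x + j v = 0 := by simpa using hx
    have h1 : A x = 0 := by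
      refine (Submodule.disjoint_def.1 hC.disjoint) _ ⟨x, rfl⟩ ?_
      rw [eq_neg_of_add_eq_zero_left hx']
      exact C.neg_mem (hjC v)
    have h2 : j v = 0 := by rwa [h1, zero_add] at hx'
    exact Prod.ext (hA (h1.trans (map_zero A).symm)) (hj (h2.trans (map_zero j).symm))
  have hcl : IsClosed (Set.range (A.coprod j)) := by
    have h := Submodule.isClosed_sup_finiteDimensional (LinearMap.range A.toLinearMap)
      (LinearMap.range j.toLinearMap) hc
    rw [← LinearMap.range_coprod] at h
    exact h
  filter_upwards [(continuous_coprod_left j).continuousAt.eventually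
    (eventually_injective_of_isClosed_range hinj hcl)] with B hB
  refine Module.le_rank_iff_exists_linearMap.2
    ⟨(LinearMap.range B.toLinearMap).mkQ ∘ₗ j.toLinearMap, ?_⟩
  refine (injective_iff_map_eq_zero _).2 fun v hv => ?_
  obtain ⟨x, hx⟩ := (Submodule.Quotient.mk_eq_zero _).1 hv
  have h0 : B.coprod j (-x, v) = 0 := by
    have hx' : B x = j v := hx
    simp [hx']
  exact congrArg Prod.snd (hB (h0.trans (map_zero _).symm))

/-- When j fills a whole complement, the extended map is bijective, and stability of bijectivity
makes closedness of the range unnecessary as an assumption. -/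
theorem eventually_codim_range_eq {A : E →L[ℂ] F} (hA : Injective A) {k : ℕ}
    (hk : Module.rank ℂ (F ⧸ LinearMap.range A.toLinearMap) = k) :
    ∀ᶠ B : E →L[ℂ] F in 𝓝 A, Module.rank ℂ (F ⧸ LinearMap.range B.toLinearMap) = k := by
  obtain ⟨C, hC⟩ := Submodule.exists_isCompl (LinearMap.range A.toLinearMap)
  rw [(Submodule.quotientEquivOfIsCompl _ _ hC).rank_eq] at hk
  obtain ⟨e⟩ := nonempty_equiv_fin hk
  let j : (Fin k → ℂ) →L[ℂ] F := LinearMap.toContinuousLinearMap (C.subtype ∘ₗ e.symm.toLinearMap)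
  have hjC : ∀ v, j v ∈ C := fun v => (e.symm v).2
  have hj : Injective j := (Submodule.injective_subtype _).comp e.symm.injective
  have hbij : Bijective (A.coprod j) := by
    constructor
    · refine (injective_iff_map_eq_zero _).2 fun ⟨x, v⟩ hx => ?_
      have hx' : A x + j v = 0 := by simpa using hx
      have h1 : A x = 0 := by
        refine (Submodule.disjoint_def.1 hC.disjoint) _ ⟨x, rfl⟩ ?_
        rw [eq_neg_of_add_eq_zero_left hx']
        exact C.neg_mem (hjC v)
      have h2 : j v = 0 := by rwa [h1, zero_add] at hx'
      exact Prod.ext (hA (h1.trans (map_zero A).symm)) (hj (h2.trans (map_zero j).symm))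
    · intro y
      obtain ⟨_, ⟨x, rfl⟩, c, hc, rfl⟩ := Submodule.mem_sup.1
        (hC.sup_eq_top ▸ Submodule.mem_top : y ∈ LinearMap.range A.toLinearMap ⊔ C)
      refine ⟨(x, e ⟨c, hc⟩), ?_⟩
      simp [j]
  filter_upwards [(continuous_coprod_left j).continuousAt.eventually
    (eventually_bijective hbij)] with B hB
  refine rank_eq_of_equiv_fin (LinearEquiv.ofBijective
    ((LinearMap.range B.toLinearMap).mkQ ∘ₗ j.toLinearMap) ⟨?_, ?_⟩).symm
  · refine (injective_iff_map_eq_zero _).2 fun v hv => ?_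
    obtain ⟨x, hx⟩ := (Submodule.Quotient.mk_eq_zero _).1 hv
    have h0 : B.coprod j (-x, v) = 0 := by
      have hx' : B x = j v := hx
      simp [hx']
    exact congrArg Prod.snd (hB.1 (h0.trans (map_zero _).symm))
  · intro q
    obtain ⟨y, rfl⟩ := Submodule.mkQ_surjective _ q
    obtain ⟨⟨x, v⟩, hxv⟩ := hB.2 y
    refine ⟨v, ?_⟩
    have : B x + j v = y := by simpa using hxv
    rw [← this, map_add]
    have h0 : (LinearMap.range B.toLinearMap).mkQ (B x) = 0 :=
      (Submodule.Quotient.mk_eq_zero _).2 ⟨x, rfl⟩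
    rw [h0, zero_add]
    rfl

end Codim

/-! ### Constancy of an ℕ∞-valued function on a connected set. -/

section Connected

/-- A function into `ℕ∞` on an open connected set that is locally constant where it is finite and
lower semicontinuous is constant if it has a finite value. -/
theorem enat_eq_of_isPreconnected {D : Set ℂ} (hD : IsPreconnected D) (ho : IsOpen D)
    (f : ℂ → ℕ∞) (hle : ∀ μ ∈ D, ∀ k : ℕ, (k : ℕ∞) ≤ f μ → ∀ᶠ ν in 𝓝 μ, (k : ℕ∞) ≤ f ν)
    (heq : ∀ μ ∈ D, ∀ k : ℕ, f μ = k → ∀ᶠ ν in 𝓝 μ, f ν = k)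
    {a b : ℂ} (ha : a ∈ D) (hb : b ∈ D) (hfa : f a < ⊤) : f b = f a := by
  obtain ⟨n, hn⟩ := ENat.ne_top_iff_exists.1 hfa.ne
  by_contra hne
  have hU : IsOpen {μ | μ ∈ D ∧ f μ = n} := by
    refine isOpen_iff_eventually.2 fun μ hμ => ?_
    filter_upwards [ho.mem_nhds hμ.1, heq μ hμ.1 n hμ.2] with ν h1 h2 using ⟨h1, h2⟩
  have hV : IsOpen {μ | μ ∈ D ∧ f μ ≠ n} := by
    refine isOpen_iff_eventually.2 fun μ hμ => ?_
    rcases lt_or_gt_of_ne hμ.2 with h | h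
    · obtain ⟨k, hk⟩ := ENat.ne_top_iff_exists.1 (h.trans_le le_top).ne
      filter_upwards [ho.mem_nhds hμ.1, heq μ hμ.1 k hk.symm] with ν h1 h2
      exact ⟨h1, by rw [h2, hk]; exact h.ne⟩
    · have h' : ((n + 1 : ℕ) : ℕ∞) ≤ f μ := by
        push_cast
        exact Order.add_one_le_of_lt h
      filter_upwards [ho.mem_nhds hμ.1, hle μ hμ.1 _ h'] with ν h1 h2
      refine ⟨h1, fun h3 => ?_⟩
      rw [h3, Nat.cast_le] at h2
      omega
  obtain ⟨μ, -, h1, h2⟩ := hD _ _ hU hV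
    (fun μ hμ => (em (f μ = n)).imp (fun h => ⟨hμ, h⟩) fun h => ⟨hμ, h⟩)
    ⟨a, ha, ha, hn.symm⟩ ⟨b, hb, hb, fun h => hne (h.trans hn)⟩
  exact h2.2 h1.2

end Connected

/-! ### The core and its quotient: nullity and defect are constant on the disc. -/

section Core

variable {E : Type*} [NormedAddCommGroup E] [NormedSpace ℂ E]

/-- The generalized range `⋂ R(V ^ n)`. -/
def core (V : E →L[ℂ] E) : Submodule ℂ E := ⨅ n : ℕ, rng (V ^ n)

theorem mem_core {V : E →L[ℂ] E} {x : E} : x ∈ core V ↔ ∀ n : ℕ, x ∈ rng (V ^ n) := by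
  simp [core]

theorem isClosed_core {V : E →L[ℂ] E} (hc : ∀ n : ℕ, IsClosed (rng (V ^ n) : Set E)) :
    IsClosed (core V : Set E) := by
  rw [core, Submodule.coe_iInf]
  exact isClosed_iInter hc

theorem mem_rng_pow_succ {V : E →L[ℂ] E} {n : ℕ} {y : E} :
    y ∈ rng (V ^ (n + 1)) ↔ ∃ x ∈ rng (V ^ n), V x = y := by
  rw [pow_succ']
  constructor
  · rintro ⟨x, rfl⟩
    exact ⟨(V ^ n) x, ⟨x, rfl⟩, rfl⟩
  · rintro ⟨_, ⟨x, rfl⟩, rfl⟩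
    exact ⟨x, rfl⟩

theorem rng_pow_antitone (V : E →L[ℂ] E) : Antitone fun n : ℕ => rng (V ^ n) := by
  refine antitone_nat_of_succ_le fun n => ?_
  rintro _ ⟨x, rfl⟩
  rw [pow_succ]
  exact ⟨V x, rfl⟩

theorem map_mem_core {V : E →L[ℂ] E} {x : E} (hx : x ∈ core V) : V x ∈ core V :=
  mem_core.2 fun n => mapsTo_rng_pow V n x (mem_core.1 hx n)

/-- A preimage of V x in R(V^n) differs from x by a kernel vector, which lies in R(V^n) too. -/
theorem mem_core_of_map_mem {V : E →L[ℂ] E} (hN : ∀ n : ℕ, nul V ≤ rng (V ^ n)) {x : E}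
    (hx : V x ∈ core V) : x ∈ core V := by
  refine mem_core.2 fun n => ?_
  obtain ⟨y, hy, hyx⟩ := mem_rng_pow_succ.1 (mem_core.1 hx (n + 1))
  have h : x - y ∈ nul V := by
    change V (x - y) = 0
    rw [map_sub, hyx, sub_self]
  simpa using add_mem (hN n h) hy

theorem exists_mem_core_map_eq {V : E →L[ℂ] E} (hN : ∀ n : ℕ, nul V ≤ rng (V ^ n)) {y : E}
    (hy : y ∈ core V) : ∃ x ∈ core V, V x = y := by
  obtain ⟨x, -, rfl⟩ := mem_rng_pow_succ.1 (mem_core.1 hy (0 + 1))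
  exact ⟨x, mem_core_of_map_mem hN hy, rfl⟩

theorem nul_le_core {V : E →L[ℂ] E} (hN : ∀ n : ℕ, nul V ≤ rng (V ^ n)) : nul V ≤ core V :=
  fun _ hx => mem_core.2 fun n => hN n hx

/-- An eigenvector with nonzero eigenvalue is the image of a multiple of itself. -/
theorem mem_rng_pow_of_map_eq_smul {V : E →L[ℂ] E} {z : ℂ} (hz : z ≠ 0) {x : E}
    (hx : V x = z • x) (n : ℕ) : x ∈ rng (V ^ n) := by
  induction n with
  | zero => exact ⟨x, rfl⟩
  | succ n ih =>
    refine mem_rng_pow_succ.2 ⟨z⁻¹ • x, Submodule.smul_mem _ _ ih, ?_⟩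
    rw [map_smul, hx, smul_smul, inv_mul_cancel₀ hz, one_smul]

/-- The restriction of `V` to its generalized range. -/
def coreRestr (V : E →L[ℂ] E) : core V →L[ℂ] core V := V.restrict fun _ hx => map_mem_core hx

/-- The operator induced by `V` on the quotient by its generalized range. -/
def coreQuot (V : E →L[ℂ] E) : (E ⧸ core V) →L[ℂ] (E ⧸ core V) :=
  (core V).liftQL ((core V).mkQL.comp V) fun _ hx =>
    (Submodule.Quotient.mk_eq_zero _).2 (map_mem_core hx)

theorem coreQuot_mk (V : E →L[ℂ] E) (x : E) :
    coreQuot V ((core V).mkQ x) = (core V).mkQ (V x) := rfl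

/-- Preimages under `V` of controlled norm, from a lower bound for the reduced minimal modulus. -/
theorem exists_map_eq_mul_norm_le {V : E →L[ℂ] E} {δ δ' : ℝ} (hδ' : 0 < δ') (hlt : δ' < δ)
    (hδ : ∀ x, δ * Metric.infDist x (nul V) ≤ ‖V x‖) (x : E) :
    ∃ x', x' - x ∈ nul V ∧ V x' = V x ∧ δ' * ‖x'‖ ≤ ‖V x‖ := by
  -- The distance to the kernel need not be attained, hence the loss from δ to δ'; it is a strict
  -- gain only when V x ≠ 0.
  by_cases hx : V x = 0
  · refine ⟨0, ?_, ?_, by simp⟩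
    · change V (0 - x) = 0
      simp [hx]
    · simp [hx]
  · have hpos : 0 < ‖V x‖ := norm_pos_iff.2 hx
    have hd : Metric.infDist x (nul V) < ‖V x‖ / δ' := by
      have hδ0 : 0 < δ := hδ'.trans hlt
      calc Metric.infDist x (nul V) ≤ ‖V x‖ / δ := by
            rw [le_div_iff₀ hδ0, mul_comm]
            exact hδ x
        _ < ‖V x‖ / δ' := div_lt_div_of_pos_left hpos hδ' hlt
    obtain ⟨n, hn, hxn⟩ := (Metric.infDist_lt_iff ⟨0, (nul V).zero_mem⟩).1 hd
    have hVn : V n = 0 := hn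
    refine ⟨x - n, ?_, ?_, ?_⟩
    · rw [sub_sub_cancel_left]
      exact (nul V).neg_mem hn
    · rw [map_sub, hVn, sub_zero]
    · rw [dist_eq_norm, lt_div_iff₀ hδ', mul_comm] at hxn
      exact hxn.le

theorem alpha_coreRestr_sub {V : E →L[ℂ] E} (hN : ∀ n : ℕ, nul V ≤ rng (V ^ n)) (z : ℂ) :
    alpha (coreRestr V - z • ContinuousLinearMap.id ℂ (core V)) =
      alpha (V - z • ContinuousLinearMap.id ℂ E) := by
  have hle : ∀ x, V x - z • x = 0 → x ∈ core V := fun x hx => by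
    by_cases hz : z = 0
    · refine nul_le_core hN (show V x = 0 from ?_)
      simpa [hz] using hx
    · exact mem_core.2 (mem_rng_pow_of_map_eq_smul hz (sub_eq_zero.1 hx))
  have e : nul (coreRestr V - z • ContinuousLinearMap.id ℂ (core V)) ≃ₗ[ℂ]
      nul (V - z • ContinuousLinearMap.id ℂ E) :=
    LinearEquiv.ofBijective
      (((core V).subtype.domRestrict _).codRestrict _ fun x =>
        congrArg Subtype.val (show _ = (0 : core V) from x.2))
      ⟨fun x y h => by
          have h' : ((x : core V) : E) = ((y : core V) : E) := 
            congrArg (fun u : nul (V - z • ContinuousLinearMap.id ℂ E) => (u : E)) h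
          exact Subtype.ext (Subtype.ext h'),
        fun x => ⟨⟨⟨x, hle x x.2⟩, Subtype.ext x.2⟩, rfl⟩⟩
  rw [alpha, alpha, e.rank_eq]

theorem continuous_sub_smul_id (V : E →L[ℂ] E) :
    Continuous fun z : ℂ => V - z • ContinuousLinearMap.id ℂ E := by fun_prop

/-- Modulo the core, V x is represented by some y of almost minimal norm. As V maps the core onto
itself, x can be changed within its class so that V x = y; as N(V) lies in the core, the quotient
norm is at most the distance to N(V). -/
theorem mul_norm_le_norm_coreQuot {V : E →L[ℂ] E} {δ : ℝ} (hδ0 : 0 ≤ δ)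
    (hδ : ∀ x, δ * Metric.infDist x (nul V) ≤ ‖V x‖)
    (hN : ∀ n : ℕ, nul V ≤ rng (V ^ n)) (q : E ⧸ core V) : δ * ‖q‖ ≤ ‖coreQuot V q‖ := by
  obtain ⟨x, rfl⟩ := (core V).mkQ_surjective q
  rw [coreQuot_mk]
  refine le_of_forall_pos_le_add fun ε hε => ?_
  obtain ⟨y, hy, hyn⟩ := Submodule.Quotient.norm_mk_lt ((core V).mkQ (V x)) hε
  have hy' : V x - y ∈ core V := (Submodule.Quotient.eq _).1 hy.symm
  obtain ⟨w, hw, hVw⟩ := exists_mem_core_map_eq hN hy'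
  have hq : (core V).mkQ x = (core V).mkQ (x - w) := by
    rw [map_sub, show (core V).mkQ w = 0 from (Submodule.Quotient.mk_eq_zero _).2 hw, sub_zero]
  have hxw : V (x - w) = y := by rw [map_sub, hVw, sub_sub_cancel]
  have hle : ‖(core V).mkQ (x - w)‖ ≤ Metric.infDist (x - w) (nul V) := by
    refine (Metric.le_infDist ⟨0, (nul V).zero_mem⟩).2 fun n hn => ?_
    have : (core V).mkQ (x - w) = (core V).mkQ (x - w - n) := by
      rw [map_sub _ _ n, show (core V).mkQ n = 0 from
        (Submodule.Quotient.mk_eq_zero _).2 (nul_le_core hN hn), sub_zero]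
    rw [this, dist_eq_norm]
    exact Submodule.Quotient.norm_mk_le _ _
  calc δ * ‖(core V).mkQ x‖ ≤ δ * Metric.infDist (x - w) (nul V) := by rw [hq]; gcongr
    _ ≤ ‖y‖ := by rw [← hxw]; exact hδ _
    _ ≤ ‖(core V).mkQ (V x)‖ + ε := hyn.le

variable [CompleteSpace E]

/-- Preimages of almost optimal norm differ from preimages in the core by kernel vectors, so they
stay in the core; a perturbation of norm below δ keeps surjectivity. -/
theorem surjective_coreRestr_sub {V : E →L[ℂ] E} {δ : ℝ}
    (hδ : ∀ x, δ * Metric.infDist x (nul V) ≤ ‖V x‖)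
    (hc : ∀ n : ℕ, IsClosed (rng (V ^ n) : Set E)) (hN : ∀ n : ℕ, nul V ≤ rng (V ^ n))
    {z : ℂ} (hz : ‖z‖ < δ) :
    Surjective (coreRestr V - z • ContinuousLinearMap.id ℂ (core V)) := by
  have : CompleteSpace (core V) := (isClosed_core hc).completeSpace_coe
  obtain ⟨δ', h1, h2⟩ := exists_between hz
  refine surjective_of_norm_sub_lt (W := coreRestr V) (δ := δ') ?_ ?_
  · rintro ⟨y, hy⟩
    obtain ⟨x, hx, rfl⟩ := exists_mem_core_map_eq hN hy
    obtain ⟨x', hx', hVx, hn⟩ :=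
      exists_map_eq_mul_norm_le ((norm_nonneg z).trans_lt h1) h2 hδ x
    have hx'c : x' ∈ core V := by simpa using add_mem (nul_le_core hN hx') hx
    exact ⟨⟨x', hx'c⟩, Subtype.ext hVx, hn⟩
  · rw [sub_sub_cancel_left, norm_neg]
    refine lt_of_le_of_lt ?_ h1
    rw [norm_smul]
    exact mul_le_of_le_one_right (norm_nonneg _) ContinuousLinearMap.norm_id_le

theorem alpha_sub_eq {V : E →L[ℂ] E} {δ : ℝ}
    (hδ : ∀ x, δ * Metric.infDist x (nul V) ≤ ‖V x‖)
    (hc : ∀ n : ℕ, IsClosed (rng (V ^ n) : Set E)) (hN : ∀ n : ℕ, nul V ≤ rng (V ^ n))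
    (hfin : alpha V < ⊤) {z : ℂ} (hz : ‖z‖ < δ) :
    alpha (V - z • ContinuousLinearMap.id ℂ E) = alpha V := by
  have : CompleteSpace (core V) := (isClosed_core hc).completeSpace_coe
  have h0 : alpha V = alpha (coreRestr V - (0 : ℂ) • ContinuousLinearMap.id ℂ (core V)) := by
    rw [alpha_coreRestr_sub hN, zero_smul, sub_zero]
  rw [h0] at hfin ⊢
  rw [← alpha_coreRestr_sub hN]
  refine enat_eq_of_isPreconnected (D := Metric.ball 0 δ)
    (f := fun z => alpha (coreRestr V - z • ContinuousLinearMap.id ℂ (core V)))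
    (convex_ball _ _).isPreconnected Metric.isOpen_ball ?_ ?_
    (Metric.mem_ball_self ((norm_nonneg z).trans_lt hz)) (mem_ball_zero_iff.2 hz) hfin
  · intro μ hμ k hk
    simp only [alpha, Cardinal.natCast_le_toENat] at hk ⊢
    exact (continuous_sub_smul_id _).continuousAt.eventually (eventually_le_rank_ker
      (surjective_coreRestr_sub hδ hc hN (mem_ball_zero_iff.1 hμ)) hk)
  · intro μ hμ k hk
    simp only [alpha, Cardinal.toENat_eq_natCast] at hk ⊢
    exact (continuous_sub_smul_id _).continuousAt.eventually (eventually_rank_ker_eq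
      (surjective_coreRestr_sub hδ hc hN (mem_ball_zero_iff.1 hμ)) hk)

/-- The range of V - z contains the core, where V - z is onto, so dividing by the core does not
change the codimension. -/
theorem beta_coreQuot_sub {V : E →L[ℂ] E} {δ : ℝ}
    (hδ : ∀ x, δ * Metric.infDist x (nul V) ≤ ‖V x‖)
    (hc : ∀ n : ℕ, IsClosed (rng (V ^ n) : Set E)) (hN : ∀ n : ℕ, nul V ≤ rng (V ^ n))
    {z : ℂ} (hz : ‖z‖ < δ) :
    Cardinal.toENat (Module.rank ℂ ((E ⧸ core V) ⧸ LinearMap.range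
      (coreQuot V - z • ContinuousLinearMap.id ℂ (E ⧸ core V)).toLinearMap)) =
      beta (V - z • ContinuousLinearMap.id ℂ E) := by
  have hle : core V ≤ rng (V - z • ContinuousLinearMap.id ℂ E) := fun y hy => by
    obtain ⟨x, hx⟩ := surjective_coreRestr_sub hδ hc hN hz ⟨y, hy⟩
    exact ⟨x, congrArg Subtype.val hx⟩
  have hmap : LinearMap.range
      (coreQuot V - z • ContinuousLinearMap.id ℂ (E ⧸ core V)).toLinearMap =
      (rng (V - z • ContinuousLinearMap.id ℂ E)).map (core V).mkQ := by
    ext q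
    constructor
    · rintro ⟨p, rfl⟩
      obtain ⟨x, rfl⟩ := (core V).mkQ_surjective p
      exact ⟨_, ⟨x, rfl⟩, rfl⟩
    · rintro ⟨_, ⟨x, rfl⟩, rfl⟩
      exact ⟨(core V).mkQ x, rfl⟩
  rw [hmap, beta, (Submodule.quotientQuotientEquivQuotient _ _ hle).rank_eq]

theorem beta_sub_eq {V : E →L[ℂ] E} {δ : ℝ}
    (hδ : ∀ x, δ * Metric.infDist x (nul V) ≤ ‖V x‖)
    (hc : ∀ n : ℕ, IsClosed (rng (V ^ n) : Set E)) (hN : ∀ n : ℕ, nul V ≤ rng (V ^ n))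
    (hfin : beta V < ⊤) {z : ℂ} (hz : ‖z‖ < δ) :
    beta (V - z • ContinuousLinearMap.id ℂ E) = beta V := by
  have : IsClosed (core V : Set E) := isClosed_core hc
  have hδ0 : 0 < δ := (norm_nonneg z).trans_lt hz
  let A : ℂ → ((E ⧸ core V) →L[ℂ] (E ⧸ core V)) := fun z =>
    coreQuot V - z • ContinuousLinearMap.id ℂ (E ⧸ core V)
  let f : ℂ → ℕ∞ := fun z =>
    Cardinal.toENat (Module.rank ℂ ((E ⧸ core V) ⧸ LinearMap.range (A z).toLinearMap))
  have hf : ∀ μ : ℂ, ‖μ‖ < δ → f μ = beta (V - μ • ContinuousLinearMap.id ℂ E) := fun μ hμ =>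
    beta_coreQuot_sub hδ hc hN hμ
  have h0 : f 0 = beta V := by
    rw [hf 0 (by simpa using hδ0), zero_smul, sub_zero]
  have hA : Continuous A := continuous_sub_smul_id _
  have hanti : ∀ μ : ℂ, ‖μ‖ < δ → ∃ K, AntilipschitzWith K (A μ) := fun μ hμ => by
    have hpos : 0 < δ - ‖μ‖ := sub_pos.2 hμ
    refine ⟨⟨(δ - ‖μ‖)⁻¹, by positivity⟩, (A μ).antilipschitz_of_bound fun q => ?_⟩
    change ‖q‖ ≤ (δ - ‖μ‖)⁻¹ * ‖coreQuot V q - μ • q‖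
    rw [le_inv_mul_iff₀ hpos, sub_mul]
    have h1 := mul_norm_le_norm_coreQuot hδ0.le hδ hN q
    have h2 := norm_sub_norm_le (coreQuot V q) (μ • q)
    rw [norm_smul] at h2
    linarith
  rw [← hf z hz, ← h0]
  refine enat_eq_of_isPreconnected (D := Metric.ball 0 δ) (f := f)
    (convex_ball _ _).isPreconnected Metric.isOpen_ball ?_ ?_
    (Metric.mem_ball_self hδ0) (mem_ball_zero_iff.2 hz) (h0 ▸ hfin)
  · intro μ hμ k hk
    obtain ⟨K, hK⟩ := hanti μ (mem_ball_zero_iff.1 hμ)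
    simp only [f, Cardinal.natCast_le_toENat] at hk ⊢
    exact hA.continuousAt.eventually (eventually_le_codim_range hK.injective
      (hK.isClosed_range (A μ).uniformContinuous) hk)
  · intro μ hμ k hk
    obtain ⟨K, hK⟩ := hanti μ (mem_ball_zero_iff.1 hμ)
    simp only [f, Cardinal.toENat_eq_natCast] at hk ⊢
    exact hA.continuousAt.eventually (eventually_codim_range_eq hK.injective hk)

end Core

/-! ### Nullity and defect along the restrictions T_[n]. -/

section Algebra

variable {E : Type*} [NormedAddCommGroup E] [NormedSpace ℂ E]

theorem mem_rng_restr {T : E →L[ℂ] E} {n : ℕ} {x : rng (T ^ n)} :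
    x ∈ rng (restr T n) ↔ (x : E) ∈ rng (T ^ (n + 1)) := by
  rw [mem_rng_pow_succ]
  constructor
  · rintro ⟨y, rfl⟩
    exact ⟨y, y.2, rfl⟩
  · rintro ⟨y, hy, hyx⟩
    exact ⟨⟨y, hy⟩, Subtype.ext hyx⟩

theorem restr_pow_apply (T : E →L[ℂ] E) (n k : ℕ) (x : rng (T ^ n)) :
    (((restr T n ^ k) x : rng (T ^ n)) : E) = (T ^ k) x := by
  induction k with
  | zero => rfl
  | succ k ih =>
    rw [pow_succ', pow_succ']
    exact congrArg T ih

theorem mem_rng_restr_pow {T : E →L[ℂ] E} {n k : ℕ} {x : rng (T ^ n)} :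
    x ∈ rng (restr T n ^ k) ↔ (x : E) ∈ rng (T ^ (n + k)) := by
  constructor
  · rintro ⟨⟨_, z, rfl⟩, rfl⟩
    refine ⟨z, ?_⟩
    rw [add_comm, pow_add]
    exact (restr_pow_apply T n k ⟨(T ^ n) z, z, rfl⟩).symm
  · rintro ⟨z, hz⟩
    refine ⟨⟨(T ^ n) z, z, rfl⟩, Subtype.ext ?_⟩
    refine (restr_pow_apply T n k _).trans ?_
    rw [← hz, add_comm, pow_add]
    rfl

theorem mem_nul_restr {T : E →L[ℂ] E} {n : ℕ} {x : rng (T ^ n)} :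
    x ∈ nul (restr T n) ↔ (x : E) ∈ nul T := Subtype.ext_iff

/-- The kernel of `T_[n]`, as a subspace of `E`. -/
def nulRng (T : E →L[ℂ] E) (n : ℕ) : Submodule ℂ E := nul T ⊓ rng (T ^ n)

theorem nulRng_antitone (T : E →L[ℂ] E) : Antitone (nulRng T) := fun _ _ h =>
  inf_le_inf_left _ (rng_pow_antitone T h)

/-- The dimension of `N(T_[n]) / N(T_[n+1])`. -/
def nulGap (T : E →L[ℂ] E) (n : ℕ) : ℕ∞ :=
  Cardinal.toENat (Module.rank ℂ (nulRng T n ⧸ (nulRng T (n + 1)).submoduleOf (nulRng T n)))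

theorem alpha_restr (T : E →L[ℂ] E) (n : ℕ) :
    alpha (restr T n) = Cardinal.toENat (Module.rank ℂ (nulRng T n)) := by
  have e : nul (restr T n) ≃ₗ[ℂ] nulRng T n :=
    LinearEquiv.ofBijective
      (((rng (T ^ n)).subtype.domRestrict (nul (restr T n))).codRestrict (nulRng T n)
        fun x => ⟨mem_nul_restr.1 x.2, x.1.2⟩)
      ⟨fun x y h => by
          have h' : ((x : rng (T ^ n)) : E) = ((y : rng (T ^ n)) : E) :=
            congrArg (fun u : nulRng T n => (u : E)) h
          exact Subtype.ext (Subtype.ext h'),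
        fun x => ⟨⟨⟨x, x.2.2⟩, mem_nul_restr.2 x.2.1⟩, rfl⟩⟩
  rw [alpha, e.rank_eq]

theorem alpha_restr_eq_add (T : E →L[ℂ] E) (n : ℕ) :
    alpha (restr T n) = alpha (restr T (n + 1)) + nulGap T n := by
  rw [alpha_restr, alpha_restr, nulGap, ← map_add, add_comm,
    ← Submodule.rank_quotient_add_rank ((nulRng T (n + 1)).submoduleOf (nulRng T n)),
    (Submodule.submoduleOfEquivOfLe (nulRng_antitone T n.le_succ)).rank_eq]

theorem beta_restr_eq_add (T : E →L[ℂ] E) (n : ℕ) :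
    beta (restr T n) = beta (restr T (n + 1)) + nulGap T n := by
  let t : rng (T ^ n) →ₗ[ℂ] rng (T ^ (n + 1)) :=
    (T.toLinearMap.domRestrict _).codRestrict _ fun x => mem_rng_pow_succ.2 ⟨x, x.2, rfl⟩
  have ht : rng (restr T n) ≤ (rng (restr T (n + 1))).comap t := fun x hx =>
    mem_rng_restr.2 (mem_rng_pow_succ.2 ⟨x, mem_rng_restr.1 hx, rfl⟩)
  let ψ := (rng (restr T n)).mapQ (rng (restr T (n + 1))) t ht
  have hψ : Surjective ψ := by
    intro q
    obtain ⟨⟨y, hy⟩, rfl⟩ := Submodule.mkQ_surjective _ q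
    obtain ⟨x, hx, rfl⟩ := mem_rng_pow_succ.1 hy
    exact ⟨(rng (restr T n)).mkQ ⟨x, hx⟩, rfl⟩
  -- θ identifies N_n/N_{n+1} with the kernel of ψ; rank-nullity for ψ then gives the formula.
  let θ : nulRng T n →ₗ[ℂ] rng (T ^ n) ⧸ rng (restr T n) :=
    (rng (restr T n)).mkQ ∘ₗ Submodule.inclusion inf_le_right
  have hker : LinearMap.ker θ = (nulRng T (n + 1)).submoduleOf (nulRng T n) := by
    ext x
    refine ((Submodule.Quotient.mk_eq_zero _).trans mem_rng_restr).trans ?_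
    exact ⟨fun h => ⟨x.2.1, h⟩, fun h => h.2⟩
  have hrange : LinearMap.range θ = LinearMap.ker ψ := by
    ext q
    constructor
    · rintro ⟨x, rfl⟩
      have : t (Submodule.inclusion inf_le_right x) = 0 := Subtype.ext x.2.1
      change (rng (restr T (n + 1))).mkQ (t (Submodule.inclusion inf_le_right x)) = 0
      rw [this, map_zero]
    · intro hq
      obtain ⟨x, rfl⟩ := Submodule.mkQ_surjective _ q
      have h1 : T x ∈ rng (T ^ (n + 1 + 1)) :=
        mem_rng_restr.1 ((Submodule.Quotient.mk_eq_zero (x := t x) _).1 hq)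
      obtain ⟨y, hy, hyx⟩ := mem_rng_pow_succ.1 h1
      have hyn : y ∈ rng (T ^ n) := rng_pow_antitone T n.le_succ hy
      have hxy : (x : E) - y ∈ nulRng T n :=
        ⟨by change T (x - y) = 0; rw [map_sub, hyx, sub_self], sub_mem x.2 hyn⟩
      refine ⟨⟨x - y, hxy⟩, ?_⟩
      refine (Submodule.Quotient.eq _).2 (mem_rng_restr.2 ?_)
      change (x : E) - y - x ∈ _
      rw [sub_sub_cancel_left]
      exact neg_mem hy
  have h1 := LinearMap.rank_eq_of_surjective hψ
  have h2 := θ.quotKerEquivRange.rank_eq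
  rw [hrange, hker] at h2
  rw [beta, beta, nulGap, h1, map_add, h2]

theorem nulGap_eq_zero_iff {T : E →L[ℂ] E} {n : ℕ} :
    nulGap T n = 0 ↔ nulRng T n = nulRng T (n + 1) := by
  rw [nulGap, Cardinal.toENat_eq_zero, rank_zero_iff,
    Submodule.Quotient.subsingleton_iff, Submodule.submoduleOf_eq_top]
  exact ⟨fun h => le_antisymm h (nulRng_antitone T n.le_succ), fun h => h.le⟩

theorem alpha_restr_add (T : E →L[ℂ] E) (n k : ℕ) :
    alpha (restr T n) = alpha (restr T (n + k)) + ∑ i ∈ Finset.range k, nulGap T (n + i) := by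
  induction k with
  | zero => simp
  | succ k ih =>
    rw [ih, Finset.sum_range_succ, alpha_restr_eq_add T (n + k), add_assoc,
      add_comm (nulGap T (n + k))]
    rfl

theorem beta_restr_add (T : E →L[ℂ] E) (n k : ℕ) :
    beta (restr T n) = beta (restr T (n + k)) + ∑ i ∈ Finset.range k, nulGap T (n + i) := by
  induction k with
  | zero => simp
  | succ k ih =>
    rw [ih, Finset.sum_range_succ, beta_restr_eq_add T (n + k), add_assoc,
      add_comm (nulGap T (n + k))]
    rfl

theorem alpha_restr_antitone (T : E →L[ℂ] E) : Antitone fun n => alpha (restr T n) :=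
  antitone_nat_of_succ_le fun n => by
    rw [alpha_restr_eq_add T n]
    exact le_self_add

theorem beta_restr_antitone (T : E →L[ℂ] E) : Antitone fun n => beta (restr T n) :=
  antitone_nat_of_succ_le fun n => by
    rw [beta_restr_eq_add T n]
    exact le_self_add

theorem alpha_sub_restr (T : E →L[ℂ] E) (n : ℕ) {z : ℂ} (hz : z ≠ 0) :
    alpha (restr T n - z • ContinuousLinearMap.id ℂ (rng (T ^ n))) =
      alpha (T - z • ContinuousLinearMap.id ℂ E) := by
  have e : nul (restr T n - z • ContinuousLinearMap.id ℂ (rng (T ^ n))) ≃ₗ[ℂ]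
      nul (T - z • ContinuousLinearMap.id ℂ E) :=
    LinearEquiv.ofBijective
      (((rng (T ^ n)).subtype.domRestrict _).codRestrict _ fun x =>
        congrArg Subtype.val (show _ = (0 : rng (T ^ n)) from x.2))
      ⟨fun x y h => by
          have h' : ((x : rng (T ^ n)) : E) = ((y : rng (T ^ n)) : E) :=
            congrArg (fun u : nul (T - z • ContinuousLinearMap.id ℂ E) => (u : E)) h
          exact Subtype.ext (Subtype.ext h'),
        fun x => ⟨⟨⟨x, mem_rng_pow_of_map_eq_smul hz (sub_eq_zero.1 x.2) n⟩,
          Subtype.ext x.2⟩, rfl⟩⟩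
  rw [alpha, alpha, e.rank_eq]

/-- Modulo R(T - z), T acts as the scalar z ≠ 0, so every class has a representative in R(T^n). -/
theorem beta_sub_restr (T : E →L[ℂ] E) (n : ℕ) {z : ℂ} (hz : z ≠ 0) :
    beta (restr T n - z • ContinuousLinearMap.id ℂ (rng (T ^ n))) =
      beta (T - z • ContinuousLinearMap.id ℂ E) := by
  let R := rng (T - z • ContinuousLinearMap.id ℂ E)
  let φ : rng (T ^ n) →ₗ[ℂ] E ⧸ R := R.mkQ ∘ₗ (rng (T ^ n)).subtype
  have hT : ∀ x, R.mkQ (T x) = z • R.mkQ x := fun x => by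
    rw [← map_smul]
    exact (Submodule.Quotient.eq _).2 ⟨x, rfl⟩
  have hTn : ∀ (k : ℕ) (x : E), R.mkQ ((T ^ k) x) = z ^ k • R.mkQ x := fun k => by
    induction k with
    | zero => intro x; rw [pow_zero, pow_zero, one_smul]; rfl
    | succ k ih =>
      intro x
      rw [pow_succ, pow_succ, mul_smul, ← hT, ← ih]
      rfl
  have hφ : Surjective φ := by
    intro q
    obtain ⟨x, rfl⟩ := R.mkQ_surjective q
    refine ⟨⟨(T ^ n) ((z ^ n)⁻¹ • x), _, rfl⟩, ?_⟩
    change R.mkQ ((T ^ n) ((z ^ n)⁻¹ • x)) = _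
    rw [hTn, map_smul, smul_smul, mul_inv_cancel₀ (pow_ne_zero n hz), one_smul]
  have hker : LinearMap.ker φ =
      rng (restr T n - z • ContinuousLinearMap.id ℂ (rng (T ^ n))) := by
    ext x
    refine (Submodule.Quotient.mk_eq_zero _).trans ⟨?_, ?_⟩
    · rintro ⟨y, hy⟩
      have hy' : T y - z • y = x := hy
      -- Solving T y - z y = x for y gains one power of T at each step, up to n.
      have hmem : ∀ k ≤ n, y ∈ rng (T ^ k) := by
        intro k
        induction k with
        | zero => exact fun _ => ⟨y, rfl⟩
        | succ k ih =>
          intro hk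
          have h1 : T y ∈ rng (T ^ (k + 1)) := mem_rng_pow_succ.2 ⟨y, ih (by omega), rfl⟩
          have h2 : (x : E) ∈ rng (T ^ (k + 1)) := rng_pow_antitone T hk x.2
          have h3 : y = z⁻¹ • (T y - x) := by
            rw [← hy', sub_sub_cancel, smul_smul, inv_mul_cancel₀ hz, one_smul]
          rw [h3]
          exact Submodule.smul_mem _ _ (sub_mem h1 h2)
      exact ⟨⟨y, hmem n le_rfl⟩, Subtype.ext hy⟩
    · rintro ⟨y, rfl⟩
      exact ⟨y, rfl⟩
  rw [beta, beta, ← hker, (φ.quotKerEquivOfSurjective hφ).rank_eq]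

end Algebra

/-! ### Essential degree and degree of stable iteration. -/

section Degrees

variable {E : Type*} [NormedAddCommGroup E] [NormedSpace ℂ E]

theorem sInf_natCast_eq_iff {P : ℕ → Prop} {k : ℕ} :
    sInf {a : ℕ∞ | ∃ n : ℕ, a = n ∧ P n} = k ↔ P k ∧ ∀ i < k, ¬ P i := by
  constructor
  · intro h
    have hne : {a : ℕ∞ | ∃ n : ℕ, a = n ∧ P n}.Nonempty := by
      by_contra hne
      rw [Set.not_nonempty_iff_eq_empty.1 hne, sInf_empty] at h
      exact ENat.top_ne_natCast k h
    have hmem := csInf_mem hne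
    rw [h] at hmem
    obtain ⟨n, hn, hP⟩ := hmem
    rw [Nat.cast_inj] at hn
    subst hn
    refine ⟨hP, fun i hi hPi => ?_⟩
    have : (k : ℕ∞) ≤ i := h ▸ sInf_le ⟨i, rfl, hPi⟩
    exact absurd (Nat.cast_le.1 this) (by omega)
  · rintro ⟨hP, hlt⟩
    refine le_antisymm (sInf_le ⟨k, rfl, hP⟩) (le_sInf ?_)
    rintro _ ⟨n, rfl, hPn⟩
    exact Nat.cast_le.2 (not_lt.1 fun h => hlt n h hPn)

theorem exists_sInf_natCast_eq {P : ℕ → Prop} (h : ∃ n, P n) :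
    ∃ k : ℕ, sInf {a : ℕ∞ | ∃ n : ℕ, a = n ∧ P n} = k := by
  classical
  exact ⟨Nat.find h, sInf_natCast_eq_iff.2 ⟨Nat.find_spec h, fun _ => Nat.find_min h⟩⟩

theorem alpha_restr_lt_top_of_beta {T : E →L[ℂ] E} {n k : ℕ}
    (hβ : beta (restr T n) < ⊤) (hα : alpha (restr T (n + k)) < ⊤) :
    alpha (restr T n) < ⊤ := by
  rw [alpha_restr_add T n k]
  rw [beta_restr_add T n k] at hβ
  exact WithTop.add_lt_top.2 ⟨hα, (WithTop.add_lt_top.1 hβ).2⟩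

theorem beta_restr_lt_top_of_alpha {T : E →L[ℂ] E} {n k : ℕ}
    (hα : alpha (restr T n) < ⊤) (hβ : beta (restr T (n + k)) < ⊤) :
    beta (restr T n) < ⊤ := by
  rw [beta_restr_add T n k]
  rw [alpha_restr_add T n k] at hα
  exact WithTop.add_lt_top.2 ⟨hβ, (WithTop.add_lt_top.1 hα).2⟩

/-- A finite defect at some i < a would make the gaps from i to a finite, and then the nullity at i
finite, against minimality of a. -/
theorem essDegree_eq_of_essAscent {T : E →L[ℂ] E} {a : ℕ} (h : essAscent T = a) :
    essDegree T = a := by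
  obtain ⟨h1, h2⟩ := sInf_natCast_eq_iff.1 h
  refine sInf_natCast_eq_iff.2 ⟨min_lt_of_left_lt h1, fun i hi hmin => ?_⟩
  rcases min_lt_iff.1 hmin with hα | hβ
  · exact h2 i hi hα
  · obtain ⟨k, rfl⟩ := Nat.exists_eq_add_of_lt hi
    exact h2 i hi (alpha_restr_lt_top_of_beta (k := k + 1) hβ h1)

theorem essDegree_eq_of_essDescent {T : E →L[ℂ] E} {b : ℕ} (h : essDescent T = b) :
    essDegree T = b := by
  obtain ⟨h1, h2⟩ := sInf_natCast_eq_iff.1 h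
  refine sInf_natCast_eq_iff.2 ⟨min_lt_of_right_lt h1, fun i hi hmin => ?_⟩
  rcases min_lt_iff.1 hmin with hα | hβ
  · obtain ⟨k, rfl⟩ := Nat.exists_eq_add_of_lt hi
    exact h2 i hi (beta_restr_lt_top_of_alpha (k := k + 1) hα h1)
  · exact h2 i hi hβ

theorem nulRng_eq_of_nulGap_eq_zero {T : E →L[ℂ] E} {m : ℕ} (h : ∀ n ≥ m, nulGap T n = 0) :
    ∀ r, m ≤ r → nulRng T m = nulRng T r := by
  intro r hr
  induction r, hr using Nat.le_induction with
  | base => rfl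
  | succ r hr ih => rw [ih, nulGap_eq_zero_iff.1 (h r hr)]

/-- An antitone sequence in `ℕ∞` with a finite value is eventually constant. -/
theorem exists_forall_ge_eq {f : ℕ → ℕ∞} (hf : Antitone f) : ∃ d, ∀ n ≥ d, f n = f d := by
  obtain ⟨_, ⟨d, rfl⟩, hd⟩ := wellFounded_lt.has_min (Set.range f) ⟨_, 0, rfl⟩
  exact ⟨d, fun n hn => le_antisymm (hf hn) (not_lt.1 (hd _ ⟨n, rfl⟩))⟩

/-- For an operator of finite essential degree `m`, the degree of stable iteration is finite
and at least `m`. -/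
theorem exists_dis_eq {T : E →L[ℂ] E} {m : ℕ} (hm : essDegree T = m) :
    ∃ d : ℕ, dis T = d ∧ m ≤ d ∧ ∀ r, d ≤ r → nulRng T d = nulRng T r := by
  obtain ⟨h1, h2⟩ := sInf_natCast_eq_iff.1 hm
  have hstab : ∃ d, ∀ r, d ≤ r → nulRng T d = nulRng T r := by
    rcases min_lt_iff.1 h1 with hα | hβ
    · obtain ⟨d, hd⟩ := exists_forall_ge_eq (alpha_restr_antitone T)
      -- Beyond d the nullity is constant and beyond m it is finite, so it cancels and leaves a zero
      -- gap.
      refine ⟨max d m, nulRng_eq_of_nulGap_eq_zero fun n hn => ?_⟩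
      have hfin : alpha (restr T n) ≠ ⊤ :=
        ((alpha_restr_antitone T (le_of_max_le_right hn)).trans_lt hα).ne
      have hs := alpha_restr_eq_add T n
      rw [hd (n + 1) (by omega), ← hd n (by omega)] at hs
      exact ENat.add_right_injective_of_ne_top hfin (hs.symm.trans (add_zero _).symm)
    · obtain ⟨d, hd⟩ := exists_forall_ge_eq (beta_restr_antitone T)
      refine ⟨max d m, nulRng_eq_of_nulGap_eq_zero fun n hn => ?_⟩
      have hfin : beta (restr T n) ≠ ⊤ :=
        ((beta_restr_antitone T (le_of_max_le_right hn)).trans_lt hβ).ne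
      have hs := beta_restr_eq_add T n
      rw [hd (n + 1) (by omega), ← hd n (by omega)] at hs
      exact ENat.add_right_injective_of_ne_top hfin (hs.symm.trans (add_zero _).symm)
  obtain ⟨d, hd⟩ := exists_sInf_natCast_eq hstab
  have hstab' := (sInf_natCast_eq_iff.1 hd).1
  refine ⟨d, hd, not_lt.1 fun hlt => h2 d hlt ?_, hstab'⟩
  -- If d < m, zero gaps would give T_[d] the nullity and defect of T_[m], against minimality of m.
  have hgap : ∀ i, nulGap T (d + i) = 0 := fun i =>
    nulGap_eq_zero_iff.2 ((hstab' _ (by omega)).symm.trans (hstab' _ (by omega)))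
  obtain ⟨k, rfl⟩ := Nat.exists_eq_add_of_lt hlt
  have hα := alpha_restr_add T d (k + 1)
  have hβ := beta_restr_add T d (k + 1)
  simp only [hgap, Finset.sum_const_zero, add_zero] at hα hβ
  rw [hα, hβ]
  exact h1

end Degrees

/-! ### Criteria for closed range. -/

section ClosedRange

variable {E F G : Type*} [NormedAddCommGroup E] [NormedSpace ℂ E] [CompleteSpace E]
  [NormedAddCommGroup F] [NormedSpace ℂ F]
  [NormedAddCommGroup G] [NormedSpace ℂ G]

theorem exists_map_eq_norm_le [CompleteSpace F] {A : E →L[ℂ] F} (hA : IsClosed (Set.range A)) :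
    ∃ C > 0, ∀ x, ∃ u, A u = A x ∧ ‖u‖ ≤ C * ‖A x‖ := by
  have : CompleteSpace (LinearMap.range A.toLinearMap) :=
    IsClosed.completeSpace_coe (hs := hA)
  obtain ⟨C, hC, h⟩ := A.rangeRestrict.exists_preimage_norm_le
    (fun ⟨y, x, hx⟩ => ⟨x, Subtype.ext hx⟩)
  refine ⟨C, hC, fun x => ?_⟩
  obtain ⟨u, hu, hn⟩ := h (A.rangeRestrict x)
  exact ⟨u, congrArg Subtype.val hu, hn⟩

/-- If `A` has closed range and `A (x k)` converges, then up to elements of the kernel of `A` a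
sequence converges to a preimage of the limit. -/
theorem exists_tendsto_of_tendsto_map [CompleteSpace F] {A : E →L[ℂ] F}
    (hA : IsClosed (Set.range A)) {x : ℕ → E} {y : F} (h : Tendsto (fun k => A (x k)) atTop (𝓝 y)) :
    ∃ x₀ : E, ∃ u : ℕ → E, A x₀ = y ∧ Tendsto u atTop (𝓝 0) ∧ ∀ k, A (x k - x₀ - u k) = 0 := by
  obtain ⟨C, -, hC⟩ := exists_map_eq_norm_le hA
  obtain ⟨x₀, rfl⟩ := hA.mem_of_tendsto h (Eventually.of_forall fun k => ⟨x k, rfl⟩)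
  choose u hu hn using fun k => hC (x k - x₀)
  refine ⟨x₀, u, rfl, ?_, fun k => by rw [map_sub, hu, sub_self]⟩
  refine squeeze_zero_norm hn ?_
  have h1 : Tendsto (fun k => A (x k - x₀)) atTop (𝓝 0) := by
    simpa using h.sub_const (A x₀)
  simpa using h1.norm.const_mul C

theorem isClosed_map_of_isClosed_sup_ker [CompleteSpace F] {A : E →L[ℂ] F}
    (hA : IsClosed (Set.range A)) {Z : Submodule ℂ E}
    (hZ : IsClosed ((Z ⊔ LinearMap.ker A.toLinearMap : Submodule ℂ E) : Set E)) :
    IsClosed (Z.map A.toLinearMap : Set F) := by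
  refine isClosed_of_closure_subset fun y hy => ?_
  obtain ⟨s, hs, hlim⟩ := mem_closure_iff_seq_limit.1 hy
  choose x hxZ hx using hs
  obtain ⟨x₀, u, rfl, hu, hker⟩ := exists_tendsto_of_tendsto_map hA
    (hlim.congr fun k => (hx k).symm)
  have hmem : x₀ ∈ Z ⊔ LinearMap.ker A.toLinearMap := by
    refine hZ.mem_of_tendsto (b := atTop) (f := fun k => x₀ + u k)
      (by simpa using hu.const_add x₀) (Eventually.of_forall fun k => ?_)
    have h1 : x₀ + u k = x k - (x k - x₀ - u k) := by abel
    rw [h1]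
    exact sub_mem (Submodule.mem_sup_left (hxZ k)) (Submodule.mem_sup_right (hker k))
  obtain ⟨z, hz, n, hn, hzn⟩ := Submodule.mem_sup.1 hmem
  refine ⟨z, hz, ?_⟩
  have hn' : A n = 0 := hn
  change A z = A x₀
  rw [← hzn, map_add, hn', add_zero]

theorem isClosed_range_of_isClosed_range_comp [CompleteSpace G] {A : F →L[ℂ] G} {B : E →L[ℂ] F}
    (hAB : IsClosed (Set.range (A.comp B)))
    (hK : IsClosed ((LinearMap.ker (A.comp B).toLinearMap).map B.toLinearMap : Set F)) :
    IsClosed (Set.range B) := by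
  refine isClosed_of_closure_subset fun y hy => ?_
  obtain ⟨s, hs, hlim⟩ := mem_closure_iff_seq_limit.1 hy
  choose x hx using hs
  obtain rfl : (fun k => B (x k)) = s := funext hx
  obtain ⟨x₀, u, -, hu, hker⟩ := exists_tendsto_of_tendsto_map hAB
    ((A.continuous.tendsto y).comp hlim)
  have hmem : y - B x₀ ∈ (LinearMap.ker (A.comp B).toLinearMap).map B.toLinearMap := by
    refine hK.mem_of_tendsto (b := atTop) (f := fun k => B (x k - x₀ - u k)) ?_
      (Eventually.of_forall fun k => ⟨_, hker k, rfl⟩)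
    have hBu : Tendsto (fun k => B (u k)) atTop (𝓝 0) := by
      have h0 := (B.continuous.tendsto 0).comp hu
      rwa [map_zero] at h0
    simpa using (hlim.sub_const (B x₀)).sub hBu
  obtain ⟨w, -, hw⟩ := hmem
  refine ⟨w + x₀, ?_⟩
  have hw' : B w = y - B x₀ := hw
  rw [map_add, hw', sub_add_cancel]

/-- After division by the kernel the operator is injective, and its range has a finite-dimensional,
hence closed, complement. -/
theorem isClosed_range_of_finite_codim [CompleteSpace F] (A : E →L[ℂ] F)
    [FiniteDimensional ℂ (F ⧸ LinearMap.range A.toLinearMap)] : IsClosed (Set.range A) := by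
  have hk : IsClosed (LinearMap.ker A.toLinearMap : Set E) := A.isClosed_ker
  let B : (E ⧸ LinearMap.ker A.toLinearMap) →L[ℂ] F :=
    (LinearMap.ker A.toLinearMap).liftQL A le_rfl
  have hr : LinearMap.range B.toLinearMap = LinearMap.range A.toLinearMap :=
    Submodule.range_liftQ _ _ _
  obtain ⟨C, hC⟩ := Submodule.exists_isCompl (LinearMap.range A.toLinearMap)
  have : FiniteDimensional ℂ C := (Submodule.quotientEquivOfIsCompl _ _ hC).finiteDimensional
  have h := B.closed_complemented_range_of_isCompl_of_ker_eq_bot C (by rw [hr]; exact hC)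
    C.closed_of_finiteDimensional (Submodule.ker_liftQ_eq_bot _ _ _ le_rfl)
  rw [hr] at h
  exact h

end ClosedRange

/-! ### Closed ranges and finiteness for semi-B-Fredholm operators. -/

section Semi

variable {E : Type*} [NormedAddCommGroup E] [NormedSpace ℂ E]

theorem isClosed_rng_of_isClosed_restr {T : E →L[ℂ] E} {n k : ℕ}
    (hn : IsClosed (rng (T ^ n) : Set E)) (hk : IsClosed (rng (restr T n ^ k) : Set (rng (T ^ n)))) :
    IsClosed (rng (T ^ (n + k)) : Set E) := by
  have h := hn.isClosedEmbedding_subtypeVal.isClosedMap _ hk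
  convert! h using 1
  ext x
  constructor
  · intro hx
    exact ⟨⟨x, rng_pow_antitone T (Nat.le_add_right n k) hx⟩, mem_rng_restr_pow.2 hx, rfl⟩
  · rintro ⟨y, hy, rfl⟩
    exact mem_rng_restr_pow.1 hy

theorem isClosed_rng_restr_pow {T : E →L[ℂ] E} {n k : ℕ}
    (h : IsClosed (rng (T ^ (n + k)) : Set E)) :
    IsClosed (rng (restr T n ^ k) : Set (rng (T ^ n))) := by
  have : (rng (restr T n ^ k) : Set (rng (T ^ n))) = Subtype.val ⁻¹' (rng (T ^ (n + k)) : Set E) :=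
    Set.ext fun _ => mem_rng_restr_pow
  rw [this]
  exact h.preimage continuous_subtype_val

theorem finiteDimensional_of_toENat_lt_top {M : Type*} [AddCommGroup M] [Module ℂ M]
    (h : Cardinal.toENat (Module.rank ℂ M) < ⊤) : FiniteDimensional ℂ M :=
  Module.rank_lt_aleph0_iff.1 (Cardinal.toENat_lt_top.1 h)

theorem exists_lt_mul_infDist_le {V : E →L[ℂ] E} {z : ℂ} (hz : ‖z‖ₑ < redMinMod V) :
    ∃ δ : ℝ, ‖z‖ < δ ∧ ∀ x, δ * Metric.infDist x (nul V) ≤ ‖V x‖ := by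
  obtain ⟨δ, h1, h2⟩ := ENNReal.lt_iff_exists_nnreal_btwn.1 hz
  have h1' : ‖z‖₊ < δ := by
    rw [enorm_eq_nnnorm] at h1
    exact ENNReal.coe_lt_coe.1 h1
  refine ⟨δ, h1', fun x => ?_⟩
  by_cases hx : x ∈ nul V
  · rw [Metric.infDist_zero_of_mem (s := (nul V : Set E)) hx, mul_zero]
    exact norm_nonneg _
  · have hcl : IsClosed (nul V : Set E) := V.isClosed_ker
    have hpos : 0 < Metric.infDist x (nul V) :=
      (hcl.notMem_iff_infDist_pos ⟨0, (nul V).zero_mem⟩).1 hx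
    have h3 : (δ : ℝ≥0∞) ≤ ENNReal.ofReal (‖V x‖ / Metric.infDist x (nul V)) :=
      h2.le.trans (iInf₂_le x hx)
    rw [← le_div_iff₀ hpos]
    rw [← ENNReal.ofReal_coe_nnreal] at h3
    exact (ENNReal.ofReal_le_ofReal_iff (by positivity)).1 h3

variable [CompleteSpace E]

theorem isClosed_rng_pow_of_finite_nul {V : E →L[ℂ] E} (hV : IsClosed (rng V : Set E))
    [FiniteDimensional ℂ (nul V)] (k : ℕ) : IsClosed (rng (V ^ k) : Set E) := by
  induction k with
  | zero =>
    have : (rng (V ^ 0) : Set E) = Set.univ := Set.eq_univ_of_forall fun x => ⟨x, rfl⟩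
    rw [this]
    exact isClosed_univ
  | succ k ih =>
    have h : IsClosed ((rng (V ^ k)).map V.toLinearMap : Set E) :=
      isClosed_map_of_isClosed_sup_ker hV (Submodule.isClosed_sup_finiteDimensional _ (nul V) ih)
    convert! h using 1
    exact Set.ext fun _ => mem_rng_pow_succ

theorem IsUpperSemiBFredholm.finite_essDegree {T : E →L[ℂ] E} (hT : IsUpperSemiBFredholm T) :
    ∃ m : ℕ, essDegree T = m ∧ alpha (restr T m) < ⊤ ∧
      ∀ n ≥ m, IsClosed (rng (T ^ n) : Set E) := by
  obtain ⟨a, ha, hcl⟩ := hT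
  have hα : alpha (restr T a) < ⊤ := (sInf_natCast_eq_iff.1 ha).1
  refine ⟨a, essDegree_eq_of_essAscent ha, hα, ?_⟩
  have hfin : FiniteDimensional ℂ (nul (restr T a)) := finiteDimensional_of_toENat_lt_top hα
  have hfin' : FiniteDimensional ℂ (nulRng T a) := by
    rw [alpha_restr] at hα
    exact finiteDimensional_of_toENat_lt_top hα
  -- R(T^{a+1}) is closed, and T^a maps N(T^{a+1}) onto N(T) ∩ R(T^a), which is finite-dimensional.
  have h0 : IsClosed (rng (T ^ a) : Set E) := by
    refine isClosed_range_of_isClosed_range_comp (A := T) (B := T ^ a) ?_ ?_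
    · rw [pow_succ'] at hcl
      exact hcl
    · have h1 : (LinearMap.ker (T.comp (T ^ a)).toLinearMap).map (T ^ a).toLinearMap =
          nulRng T a := by
        ext y
        constructor
        · rintro ⟨x, hx, rfl⟩
          exact ⟨hx, x, rfl⟩
        · rintro ⟨hy, x, rfl⟩
          exact ⟨x, hy, rfl⟩
      rw [h1]
      exact Submodule.closed_of_finiteDimensional _
  have : CompleteSpace (rng (T ^ a)) := h0.completeSpace_coe
  intro n hn
  obtain ⟨k, rfl⟩ := Nat.exists_eq_add_of_le hn
  refine isClosed_rng_of_isClosed_restr h0 (isClosed_rng_pow_of_finite_nul ?_ k)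
  have := isClosed_rng_restr_pow (T := T) (n := a) (k := 1) hcl
  rwa [pow_one] at this

theorem IsLowerSemiBFredholm.finite_essDegree {T : E →L[ℂ] E} (hT : IsLowerSemiBFredholm T) :
    ∃ m : ℕ, essDegree T = m ∧ beta (restr T m) < ⊤ ∧
      ∀ n ≥ m, IsClosed (rng (T ^ n) : Set E) := by
  obtain ⟨b, hb, hcl⟩ := hT
  have hβ : beta (restr T b) < ⊤ := (sInf_natCast_eq_iff.1 hb).1
  refine ⟨b, essDegree_eq_of_essDescent hb, hβ, fun n hn => ?_⟩
  induction n, hn using Nat.le_induction with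
  | base => exact hcl
  | succ n hn ih =>
    have : CompleteSpace (rng (T ^ n)) := ih.completeSpace_coe
    have hfin : FiniteDimensional ℂ
        (rng (T ^ n) ⧸ LinearMap.range (restr T n).toLinearMap) :=
      finiteDimensional_of_toENat_lt_top ((beta_restr_antitone T hn).trans_lt hβ)
    refine isClosed_rng_of_isClosed_restr ih ?_
    rw [pow_one]
    exact isClosed_range_of_finite_codim (restr T n)

theorem redMinMod_pos {V : E →L[ℂ] E} (hV : IsClosed (rng V : Set E)) : 0 < redMinMod V := by
  obtain ⟨C, hC, h⟩ := exists_map_eq_norm_le (A := V) hV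
  refine (ENNReal.ofReal_pos.2 (inv_pos.2 hC)).trans_le (le_iInf₂ fun x hx => ?_)
  refine ENNReal.ofReal_le_ofReal ?_
  have hcl : IsClosed (nul V : Set E) := V.isClosed_ker
  have hpos : 0 < Metric.infDist x (nul V) :=
    (hcl.notMem_iff_infDist_pos ⟨0, (nul V).zero_mem⟩).1 hx
  rw [le_div_iff₀ hpos, inv_mul_le_iff₀ hC]
  obtain ⟨u, hu, hn⟩ := h x
  have hmem : x - u ∈ (nul V : Set E) := by
    change V (x - u) = 0
    rw [map_sub, hu, sub_self]
  have := Metric.infDist_le_dist_of_mem (x := x) hmem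
  rw [dist_eq_norm, sub_sub_cancel] at this
  exact this.trans hn

end Semi

/-! ### Existence, uniqueness and vanishing of the jump. -/

section Jump

variable {E : Type*} [NormedAddCommGroup E] [NormedSpace ℂ E]

theorem HasJump.unique {T : E →L[ℂ] E} (hT : IsSemiBFredholm T) {i j : ℕ} (hi : HasJump T i)
    (hj : HasJump T j) : i = j := by
  obtain ⟨r, h0, hr⟩ := ENNReal.lt_iff_exists_nnreal_btwn.1 hi.1
  have hr0 : 0 < r := ENNReal.coe_pos.1 h0
  have hz : ((r : ℝ) : ℂ) ≠ 0 := by exact_mod_cast hr0.ne'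
  have hzr : ‖((r : ℝ) : ℂ)‖ₑ < stabRadius T := by
    have : ‖((r : ℝ) : ℂ)‖ₑ = r := by
      rw [enorm_eq_nnnorm]
      simp
    rwa [this]
  have key : ∀ a b : ℕ∞, a < ⊤ → a = b + i → a = b + j → i = j := fun a b ha h1 h2 => by
    have hb : b ≠ ⊤ := by
      rintro rfl
      simp [h1] at ha
    exact Nat.cast_inj.1 (ENat.add_right_injective_of_ne_top hb (h1.symm.trans h2))
  rcases hT with h | h
  · obtain ⟨h1, h2⟩ := (hi.2 _ hz hzr).1 h
    exact key _ _ h1 h2 ((hj.2 _ hz hzr).1 h).2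
  · obtain ⟨h1, h2⟩ := (hi.2 _ hz hzr).2 h
    exact key _ _ h1 h2 ((hj.2 _ hz hzr).2 h).2

theorem dis_eq_zero_iff {T : E →L[ℂ] E} :
    dis T = 0 ↔ ∀ r, nulRng T 0 = nulRng T r := by
  rw [← Nat.cast_zero, dis, sInf_natCast_eq_iff]
  exact ⟨fun h r => h.1 r r.zero_le, fun h => ⟨fun r _ => h r, fun i hi => absurd hi i.not_lt_zero⟩⟩

theorem isSemiRegular_restr_iff {T : E →L[ℂ] E} {m : ℕ}
    (hc : IsClosed (rng (T ^ (m + 1)) : Set E)) :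
    IsSemiRegular (restr T m) ↔ ∀ r, m ≤ r → nulRng T m = nulRng T r := by
  have hcl := isClosed_rng_restr_pow (T := T) (n := m) (k := 1) hc
  rw [pow_one] at hcl
  have hmem : ∀ (r : ℕ) (x : rng (T ^ m)),
      x ∈ nulRng (restr T m) r ↔ (x : E) ∈ nulRng T (m + r) := fun r x =>
    and_congr mem_nul_restr mem_rng_restr_pow
  rw [IsSemiRegular, and_iff_right hcl, dis_eq_zero_iff]
  constructor
  · intro h r hr
    obtain ⟨k, rfl⟩ := Nat.exists_eq_add_of_le hr
    refine le_antisymm (fun x hx => ?_) (nulRng_antitone T hr)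
    refine (hmem k ⟨x, hx.2⟩).1 ?_
    rw [← h k]
    exact (hmem 0 ⟨x, hx.2⟩).2 hx
  · intro h r
    ext x
    rw [hmem, hmem, ← h (m + 0) (by omega), ← h (m + r) (by omega)]

theorem isSemiRegular_iff_of_isClosed {T : E →L[ℂ] E} (hc : IsClosed (rng (T ^ 1) : Set E)) :
    IsSemiRegular T ↔ ∀ r, 0 ≤ r → nulRng T 0 = nulRng T r := by
  rw [pow_one] at hc
  rw [IsSemiRegular, and_iff_right hc, dis_eq_zero_iff]
  exact ⟨fun h r _ => h r, fun h r => h r r.zero_le⟩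

variable [CompleteSpace E]

theorem exists_essDegree_eq {T : E →L[ℂ] E} (hT : IsSemiBFredholm T) :
    ∃ m : ℕ, essDegree T = m ∧ (IsUpperSemiBFredholm T → alpha (restr T m) < ⊤) ∧
      (IsLowerSemiBFredholm T → beta (restr T m) < ⊤) ∧
      ∀ n ≥ m, IsClosed (rng (T ^ n) : Set E) := by
  have hu : ∀ m : ℕ, essDegree T = m → IsUpperSemiBFredholm T → alpha (restr T m) < ⊤ :=
    fun m hm h => by
      obtain ⟨m', hm', hα, -⟩ := h.finite_essDegree
      obtain rfl : m = m' := Nat.cast_inj.1 (hm.symm.trans hm')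
      exact hα
  have hl : ∀ m : ℕ, essDegree T = m → IsLowerSemiBFredholm T → beta (restr T m) < ⊤ :=
    fun m hm h => by
      obtain ⟨m', hm', hβ, -⟩ := h.finite_essDegree
      obtain rfl : m = m' := Nat.cast_inj.1 (hm.symm.trans hm')
      exact hβ
  rcases hT with h | h
  · obtain ⟨m, hm, -, hc⟩ := h.finite_essDegree
    exact ⟨m, hm, hu m hm, hl m hm, hc⟩
  · obtain ⟨m, hm, -, hc⟩ := h.finite_essDegree
    exact ⟨m, hm, hu m hm, hl m hm, hc⟩

/-- The jump exists; it vanishes precisely if the kernels of the `T_[n]` are constant from the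
essential degree on. -/
theorem exists_hasJump {T : E →L[ℂ] E} (hT : IsSemiBFredholm T) {m : ℕ}
    (hm : essDegree T = m) :
    ∃ j : ℕ, HasJump T j ∧ (j = 0 ↔ ∀ r, m ≤ r → nulRng T m = nulRng T r) := by
  obtain ⟨m', hm', hu, hl, hc⟩ := exists_essDegree_eq hT
  obtain rfl : m = m' := Nat.cast_inj.1 (hm.symm.trans hm')
  obtain ⟨d, hd, hmd, hstab⟩ := exists_dis_eq hm
  obtain ⟨k, rfl⟩ := Nat.exists_eq_add_of_le hmd
  have hsum : (∑ i ∈ Finset.range k, nulGap T (m + i)) < ⊤ := by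
    rcases hT with h | h
    · have := hu h
      rw [alpha_restr_add T m k] at this
      exact (WithTop.add_lt_top.1 this).2
    · have := hl h
      rw [beta_restr_add T m k] at this
      exact (WithTop.add_lt_top.1 this).2
  -- The jump is the sum of the gaps between m and dis(T) = m + k.
  obtain ⟨j, hj⟩ := ENat.ne_top_iff_exists.1 hsum.ne
  have hcd : IsClosed (rng (T ^ (m + k)) : Set E) := hc _ (Nat.le_add_right m k)
  have : CompleteSpace (rng (T ^ (m + k))) := hcd.completeSpace_coe
  have hcl : ∀ n : ℕ, IsClosed (rng (restr T (m + k) ^ n) : Set (rng (T ^ (m + k)))) := fun n =>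
    isClosed_rng_restr_pow (hc _ (by omega))
  have hN : ∀ n : ℕ, nul (restr T (m + k)) ≤ rng (restr T (m + k) ^ n) := fun n x hx => by
    have h1 : (x : E) ∈ nulRng T (m + k) := ⟨mem_nul_restr.1 hx, x.2⟩
    rw [hstab (m + k + n) (by omega)] at h1
    exact mem_rng_restr_pow.2 h1.2
  have hrad : stabRadius T = redMinMod (restr T (m + k)) := by
    rw [stabRadius, hd, ENat.toNat_natCast]
  have hα : alpha (essRestr T) = alpha (restr T m) := by
    rw [essRestr, hm, ENat.toNat_natCast]
  have hβ : beta (essRestr T) = beta (restr T m) := by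
    rw [essRestr, hm, ENat.toNat_natCast]
  refine ⟨j, ⟨?_, fun z hz hzr => ⟨fun h => ?_, fun h => ?_⟩⟩, ?_⟩
  · rw [hrad]
    have := hcl 1
    rw [pow_one] at this
    exact redMinMod_pos this
  · rw [hrad] at hzr
    obtain ⟨δ, h1, h2⟩ := exists_lt_mul_infDist_le hzr
    have hfin := (alpha_restr_antitone T (Nat.le_add_right m k)).trans_lt (hu h)
    have h3 := alpha_sub_eq h2 hcl hN hfin h1
    rw [alpha_sub_restr T _ hz] at h3
    rw [hα, h3, hj, ← alpha_restr_add]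
    exact ⟨hu h, rfl⟩
  · rw [hrad] at hzr
    obtain ⟨δ, h1, h2⟩ := exists_lt_mul_infDist_le hzr
    have hfin := (beta_restr_antitone T (Nat.le_add_right m k)).trans_lt (hl h)
    have h3 := beta_sub_eq h2 hcl hN hfin h1
    rw [beta_sub_restr T _ hz] at h3
    rw [hβ, h3, hj, ← beta_restr_add]
    exact ⟨hl h, rfl⟩
  · rw [← Nat.cast_inj (R := ℕ∞), hj, Nat.cast_zero, Finset.sum_eq_zero_iff]
    constructor
    · intro h
      refine nulRng_eq_of_nulGap_eq_zero fun n hn => ?_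
      obtain ⟨i, rfl⟩ := Nat.exists_eq_add_of_le hn
      by_cases hi : i < k
      · exact h i (Finset.mem_range.2 hi)
      · exact nulGap_eq_zero_iff.2 ((hstab _ (by omega)).symm.trans (hstab _ (by omega)))
    · exact fun h i _ => nulGap_eq_zero_iff.2 ((h _ (by omega)).symm.trans (h _ (by omega)))

end Jump

end BFredholm

end

theorem mainTheorem8 {X : Type*} [NormedAddCommGroup X] [NormedSpace ℂ X] [CompleteSpace X]
    (T : X →L[ℂ] X) (hT : BFredholm.IsSemiBFredholm T) :
    BFredholm.HasJump T (BFredholm.jump T) ∧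
    (BFredholm.IsSemiRegular (BFredholm.essRestr T) ↔ BFredholm.jump T = 0) ∧
    (BFredholm.IsSemiFredholm T → (BFredholm.IsSemiRegular T ↔ BFredholm.jump T = 0)) := by
  obtain ⟨m, hm, -, -, hc⟩ := BFredholm.exists_essDegree_eq hT
  obtain ⟨j, hj, hj0⟩ := BFredholm.exists_hasJump hT hm
  have hjump : BFredholm.jump T = j :=
    BFredholm.HasJump.unique hT (Nat.sInf_mem (s := {j | BFredholm.HasJump T j}) ⟨j, hj⟩) hj
  rw [hjump]
  refine ⟨hj, ?_, fun hF => ?_⟩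
  · rw [hj0, BFredholm.essRestr, hm, ENat.toNat_natCast]
    exact BFredholm.isSemiRegular_restr_iff (hc _ m.le_succ)
  · obtain rfl : m = 0 := Nat.cast_inj.1 (hm.symm.trans hF.2)
    rw [hj0]
    exact BFredholm.isSemiRegular_iff_of_isClosed (hc 1 (Nat.zero_le 1))
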